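/- Let $W\sim\mathcal P_W$ be a random parameter in a measurable space $\mathcal W$, and let $X$, with values in a measurable space $\mathcal X$, be drawn from $\mathcal P_{X|W=w}$ given $W=w$, where $\mathcal P_{X|W}$ is a Markov kernel. Let $\ell:\mathcal W\times\hat{\mathcal W}\to[0,\infty)$ be a jointly measurable loss. For an estimator, i.e. a measurable map $\phi:\mathcal X\to\hat{\mathcal W}$, put $\hat W=\phi(X)$, let $R(\phi)=\mathbb E[\ell(W,\hat W)]$ be its risk, and let $$L_{\hat W}(\rho)=\sup_{w\in\mathcal W}\mathcal P_{\hat W}\big(\ell(w,\hat W)<\rho\big)$$ be the small-ball probability of $\hat W$. The Bayesian risk is $R_B=\inf_\phi R(\phi)$, the infimum over all estimators. For $\alpha>1$ the Rényi divergence is $D_\alpha(P\|Q)=\frac1{\alpha-1}\log\int p^\alpha q^{1-\alpha}\,d\mu$, where $p,q$ are the densities of $P,Q$ with respect to a common dominating measure $\mu$, and Sibson's mutual information is $I_\alpha(X,W)=\inf_{\mathcal Q_W}D_\alpha(\mathcal P_{XW}\|\mathcal P_X\otimes\mathcal Q_W)$, over all probability measures $\mathcal Q_W$ on $\mathcal W$.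 The maximal leakage from $X$ to $W$ is $$\mathcal L(X\to W)=\sup_{U-X-W-\hat U}\log\frac{\mathbb P(U=\hat U)}{\max_u\mathbb P(U=u)},$$ the supremum over all Markov chains $U-X-W-\hat U$ with $U,\hat U$ in a common, arbitrary finite alphabet. All these quantities may be infinite; $\log 0=-\infty$, $\exp(-\infty)=0$, $\exp(\infty)=\infty$. Then for every $\alpha>1$, every $\rho>0$ and every estimator $\hat W=\phi(X)$, $$R(\phi)\ \ge\ \rho\left(1-\exp\left(\frac{\alpha-1}{\alpha}\big(I_\alpha(X,W)+\log L_{\hat W}(\rho)\big)\right)\right),$$ and, in the case $\alpha\to\infty$, $$R(\phi)\ \ge\ \rho\Big(1-\exp\big(\mathcal L(X\to W)+\log L_{\hat W}(\rho)\big)\Big).$$ Moreover, let $\Phi$ be any set of estimators with $\inf_{\phi\in\Phi}R(\phi)=R_B$ (for instance the set of all estimators, or a single Bayes-optimal estimator). Then both bounds hold with $R_B$ in place of $R(\phi)$ and with $\sup_{\phi\in\Phi}L_{\phi(X)}(\rho)$ in place of $L_{\hat W}(\rho)$. Each inequality is asserted except where its exponent is the undefined expression $\infty+(-\infty)$, that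 is, where the information measure is $\infty$ and the small-ball probability is $0$. -/

import Mathlib

open MeasureTheory ProbabilityTheory
open scoped ENNReal NNReal

noncomputable section

namespace BayesLowerBound

/-- Rényi's divergence `D_α(P‖Q) = (α - 1)⁻¹ log ∫ p ^ α q ^ (1 - α) dμ` of order `α ≠ 1`, where
`p`, `q` are the densities of `P`, `Q` with respect to the dominating measure `μ = P + Q`.
The integrand is `[0, ∞]`-valued: for `α > 1` it is `∞` where `q = 0 < p`. -/
def renyiDiv {Ω : Type*} [MeasurableSpace Ω] (α : ℝ) (P Q : Measure Ω) : EReal :=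
  (((α - 1)⁻¹ : ℝ) : EReal) *
    ENNReal.log (∫⁻ x, P.rnDeriv (P + Q) x ^ α * Q.rnDeriv (P + Q) x ^ (1 - α) ∂(P + Q))

/-- Sibson's mutual information `I_α(A, B) = inf_Q D_α(P_{AB} ‖ P_A ⊗ Q)` of order `α`, where `J`
is the joint law of `(A, B)` and `Q` ranges over the probability measures on the second space. -/
def sibsonMI {𝒜 ℬ : Type*} [MeasurableSpace 𝒜] [MeasurableSpace ℬ] (α : ℝ)
    (J : Measure (𝒜 × ℬ)) : EReal :=
  ⨅ (Q : Measure ℬ) (_ : IsProbabilityMeasure Q), renyiDiv α J (J.fst.prod Q)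

/-- The maximal leakage from `A` to `B`, where `J` is the joint law of `(A, B)`:
the supremum of `log (ℙ(U = Û) / max_u ℙ(U = u))` over all Markov chains `U - A - B - Û` with
`U` and `Û` in a common finite alphabet. Such a chain is given by a channel `κ` that produces `U`
from `A` and a channel `η` that produces `Û` from `B`; then `(κ ∥ₖ η) ∘ₘ J` is the law of
`(U, Û)` and `κ ∘ₘ J.fst` is the law of `U`. -/
def maximalLeakage {𝒜 ℬ : Type*} [MeasurableSpace 𝒜] [MeasurableSpace ℬ]
    (J : Measure (𝒜 × ℬ)) : EReal :=
  ⨆ (n : ℕ) (κ : Kernel 𝒜 (Fin n)) (η : Kernel ℬ (Fin n))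
    (_ : IsMarkovKernel κ) (_ : IsMarkovKernel η),
    ENNReal.log (((κ ∥ₖ η) ∘ₘ J) {p | p.1 = p.2} / ⨆ u : Fin n, (κ ∘ₘ J.fst) {u})

section Framework

variable {𝒲 𝒳 𝒱 : Type*} [MeasurableSpace 𝒲] [MeasurableSpace 𝒳] [MeasurableSpace 𝒱]

/-- The joint law of `(X, W)` when `W ∼ π` and `X ∼ P w` given `W = w`. -/
def jointXW (π : Measure 𝒲) (P : Kernel 𝒲 𝒳) : Measure (𝒳 × 𝒲) :=
  (π ⊗ₘ P).map Prod.swap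

/-- The law of the estimate `Ŵ = φ(X)`. -/
def estimateLaw (π : Measure 𝒲) (P : Kernel 𝒲 𝒳) (φ : 𝒳 → 𝒱) : Measure 𝒱 :=
  (P ∘ₘ π).map φ

/-- The expected loss `𝔼 ℓ(W, φ(X))` of the estimator `φ`. -/
def estimatorRisk (π : Measure 𝒲) (P : Kernel 𝒲 𝒳) (l : 𝒲 → 𝒱 → ℝ≥0) (φ : 𝒳 → 𝒱) : ℝ≥0∞ :=
  ∫⁻ p, (l p.1 (φ p.2) : ℝ≥0∞) ∂(π ⊗ₘ P)

/-- The Bayesian risk: the infimum of the expected loss over all (measurable) estimators. -/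
def bayesianRisk (π : Measure 𝒲) (P : Kernel 𝒲 𝒳) (l : 𝒲 → 𝒱 → ℝ≥0) : ℝ≥0∞ :=
  ⨅ φ : {φ : 𝒳 → 𝒱 // Measurable φ}, estimatorRisk π P l φ.1

/-- The small-ball probability `sup_w ℙ(ℓ(w, Ŵ) < ρ)` of the estimate `Ŵ = φ(X)`. -/
def smallBallEst (π : Measure 𝒲) (P : Kernel 𝒲 𝒳) (l : 𝒲 → 𝒱 → ℝ≥0) (φ : 𝒳 → 𝒱) (ρ : ℝ) :
    ℝ≥0∞ :=
  ⨆ w : 𝒲, estimateLaw π P φ {v | (l w v : ℝ) < ρ}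

/-- The largest small-ball probability of an estimate, over a class `Φ` of estimators. -/
def smallBallClass (π : Measure 𝒲) (P : Kernel 𝒲 𝒳) (l : 𝒲 → 𝒱 → ℝ≥0) (Φ : Set (𝒳 → 𝒱))
    (ρ : ℝ) : ℝ≥0∞ :=
  ⨆ φ ∈ Φ, smallBallEst π P l φ ρ

end Framework

/-- The extended real `ρ (1 - exp (c (I + log L)))`, with `log 0 = -∞`, `exp (-∞) = 0`,
`exp ∞ = ∞`. It is meaningful unless `I = ∞` and `L = 0`. -/
def lowerBound (ρ c : ℝ) (I : EReal) (L : ℝ≥0∞) : EReal :=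
  (ρ : EReal) * (1 - ((EReal.exp ((c : EReal) * (I + ENNReal.log L)) : ℝ≥0∞) : EReal))

end BayesLowerBound

end

/-! Let `J` be the joint law of `(X, W)` and `E` the event `ℓ(w, φ(x)) < ρ`. Markov's inequality
gives `ρ ≤ R(φ) + ρ J(E)`, and the `w`-section of `E` has `P_X`-mass `ℙ(ℓ(w, Ŵ) < ρ)`. It remains to
bound `J(E)` by `(exp I · L) ^ c`, where `L` is the supremum of the section masses.

For Sibson's information, Hölder's inequality compares `J(E)` with `(P_X ⊗ Q)(E)`
(`measure_le_exp_renyiDiv_mul_rpow`). The latter is at most `L` for every `Q`, so the infimum over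
`Q` can be taken.

For maximal leakage, let `U` name a section `A` of `E`, with probability proportional to `1_A(X) /
P_X(A)`, and let `Û` name the section at `W`. The success ratio is `𝔼[1_E / P_X(E_W)]`, which is at
least `J(E) / L`. The alphabet must be finite, so `E` is first approximated by sets with finitely
many sections (`measure_le_add_exp_maximalLeakage_mul`). -/

namespace BayesLowerBound

/-! ### Markov's inequality and the extended-real bound -/

/-- Markov's inequality, in the form used to bound a risk from below. -/
lemma le_lintegral_add_mul_measure_lt {Ω : Type*} [MeasurableSpace Ω] (μ : Measure Ω)
    [IsProbabilityMeasure μ] {f : Ω → ℝ≥0} (hf : Measurable f) (ρ : ℝ) :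
    ENNReal.ofReal ρ ≤ ∫⁻ x, (f x : ℝ≥0∞) ∂μ + ENNReal.ofReal ρ * μ {x | (f x : ℝ) < ρ} := by
  have hE : MeasurableSet {x | (f x : ℝ) < ρ} :=
    measurableSet_lt (by fun_prop) measurable_const
  have h1 : ENNReal.ofReal ρ * μ {x | (f x : ℝ) < ρ}ᶜ ≤ ∫⁻ x, (f x : ℝ≥0∞) ∂μ := by
    have h := mul_meas_ge_le_lintegral (μ := μ) (f := fun x => (f x : ℝ≥0∞)) (by fun_prop)
      (ENNReal.ofReal ρ)
    refine le_trans ?_ h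
    gcongr
    intro x hx
    simp only [Set.mem_compl_iff, Set.mem_ofPred_eq, not_lt] at hx ⊢
    exact ENNReal.ofReal_le_of_le_toReal (by simpa using hx)
  calc ENNReal.ofReal ρ
      = ENNReal.ofReal ρ * (μ {x | (f x : ℝ) < ρ} + μ {x | (f x : ℝ) < ρ}ᶜ) := by
        rw [measure_add_measure_compl hE, measure_univ, mul_one]
    _ = ENNReal.ofReal ρ * μ {x | (f x : ℝ) < ρ}ᶜ + ENNReal.ofReal ρ * μ {x | (f x : ℝ) < ρ} := by
        rw [mul_add, add_comm]
    _ ≤ _ := by gcongr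

/-- The additive hypothesis avoids truncated subtraction in `[0, ∞]`. If the exponential factor is
infinite, the bound is `⊥`. -/
lemma lowerBound_le_coe_of_le_add {ρ : ℝ} (hρ : 0 < ρ) {c : ℝ} {I : EReal} {L R : ℝ≥0∞}
    (h : ENNReal.ofReal ρ ≤ R + ENNReal.ofReal ρ * (EReal.exp I * L) ^ c) :
    lowerBound ρ c I L ≤ (R : EReal) := by
  have he : EReal.exp ((c : EReal) * (I + ENNReal.log L)) = (EReal.exp I * L) ^ c := by
    rw [mul_comm, EReal.exp_mul, EReal.exp_add, ENNReal.exp_log]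
  rw [lowerBound, he]
  generalize (EReal.exp I * L) ^ c = e at h
  induction e with
  | top => simp [EReal.coe_mul_bot_of_pos hρ]
  | coe e =>
    induction R with
    | top => simp
    | coe R =>
      have h' : ρ ≤ R + ρ * e := by
        have := ENNReal.toReal_mono (by finiteness) h
        rwa [ENNReal.toReal_add (by finiteness) (by finiteness), ENNReal.toReal_mul,
          ENNReal.toReal_ofReal hρ.le] at this
      have : ((ρ * (1 - (e : ℝ)) : ℝ) : EReal) ≤ ((R : ℝ) : EReal) := by
        rw [EReal.coe_le_coe_iff]; linarith
      simpa [EReal.coe_nnreal_eq_coe_real] using this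

/-- Infinite information makes the bound trivial, so the estimates of `J E` are needed only for `I ≠
⊤`. -/
lemma lowerBound_top {ρ : ℝ} (hρ : 0 < ρ) {c : ℝ} (hc : 0 < c) {L : ℝ≥0∞} (hL : L ≠ 0) :
    lowerBound ρ c ⊤ L = ⊥ := by
  have : (⊤ : EReal) + ENNReal.log L = ⊤ := EReal.top_add_of_ne_bot (by simpa using hL)
  simp [lowerBound, this, EReal.coe_mul_top_of_pos hc, EReal.coe_mul_bot_of_pos hρ]

/-! ### Rényi divergence and Sibson's mutual information -/

/-- The density of `P` is bounded by a product that Hölder's inequality separates into the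
integral of Rényi's divergence and the mass of `Q`. -/
lemma measure_le_exp_renyiDiv_mul_rpow {Ω : Type*} [MeasurableSpace Ω] {α : ℝ} (hα : 1 < α)
    (P Q : Measure Ω) [IsProbabilityMeasure P] [IsProbabilityMeasure Q] (E : Set Ω)
    (hP : EReal.exp (renyiDiv α P Q) ≠ ∞) :
    P E ≤ (EReal.exp (renyiDiv α P Q) * Q E) ^ ((α - 1) / α) := by
  have hα0 : 0 < α := by linarith
  have hα1 : 0 < α - 1 := by linarith
  set m := P + Q
  set p := P.rnDeriv m
  set q := Q.rnDeriv m
  have hpm : Measurable p := Measure.measurable_rnDeriv _ _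
  have hqm : Measurable q := Measure.measurable_rnDeriv _ _
  set S := ∫⁻ x, p x ^ α * q x ^ (1 - α) ∂m with hS
  have hexp : EReal.exp (renyiDiv α P Q) = S ^ (α - 1)⁻¹ := by
    rw [ENNReal.rpow_eq_exp_mul_log]; rfl
  rw [hexp] at hP ⊢
  have hS_top : S ≠ ∞ := fun h => hP (by rw [h, ENNReal.top_rpow_of_pos (by positivity)])
  have hPac : P ≪ m := (Measure.le_add_right le_rfl).absolutelyContinuous
  have hQac : Q ≪ m := (Measure.le_add_left le_rfl).absolutelyContinuous
  have hPE : P E = ∫⁻ x in E, p x ∂m := (Measure.setLIntegral_rnDeriv hPac E).symm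
  have hQE : Q E = ∫⁻ x in E, q x ∂m := (Measure.setLIntegral_rnDeriv hQac E).symm
  have hfm : Measurable fun x => (p x ^ α * q x ^ (1 - α)) := by fun_prop
  have hfin : ∀ᵐ x ∂m, p x ^ α * q x ^ (1 - α) < ∞ := ae_lt_top hfm hS_top
  have hqfin : ∀ᵐ x ∂m, q x < ∞ := Measure.rnDeriv_lt_top _ _
  have hle : ∀ᵐ x ∂m, p x ≤
      (p x ^ α * q x ^ (1 - α)) ^ (1 / α) * q x ^ ((α - 1) / α) := by
    filter_upwards [hfin, hqfin] with x hx hqx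
    rcases eq_or_ne (p x) 0 with h0 | h0
    · simp [h0]
    -- Where `q = 0 < p` the integrand is `∞`, which finiteness of `S` excludes almost everywhere.
    have hq0 : q x ≠ 0 := by
      intro h
      rw [h, ENNReal.zero_rpow_of_neg (by linarith), ENNReal.mul_top] at hx
      · exact lt_irrefl _ hx
      · simp [h0, hα0.le]
    rw [ENNReal.mul_rpow_of_nonneg _ _ (by positivity), ← ENNReal.rpow_mul, ← ENNReal.rpow_mul,
      mul_assoc, ← ENNReal.rpow_add _ _ hq0 hqx.ne]
    have e1 : α * (1 / α) = 1 := by field_simp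
    have e2 : (1 - α) * (1 / α) + (α - 1) / α = 0 := by ring
    simp only [e1, e2, ENNReal.rpow_one, ENNReal.rpow_zero, mul_one, le_refl]
  have hconj : α.HolderConjugate (α / (α - 1)) := Real.HolderConjugate.conjExponent hα
  calc P E = ∫⁻ x in E, p x ∂m := hPE
    _ ≤ ∫⁻ x in E, (p x ^ α * q x ^ (1 - α)) ^ (1 / α) * q x ^ ((α - 1) / α) ∂m :=
        lintegral_mono_ae (ae_restrict_of_ae hle)
    _ ≤ (∫⁻ x in E, ((p x ^ α * q x ^ (1 - α)) ^ (1 / α)) ^ α ∂m) ^ (1 / α) *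
          (∫⁻ x in E, (q x ^ ((α - 1) / α)) ^ (α / (α - 1)) ∂m) ^ (1 / (α / (α - 1))) :=
        ENNReal.lintegral_mul_le_Lp_mul_Lq _ hconj (by fun_prop) (by fun_prop)
    _ = (∫⁻ x in E, p x ^ α * q x ^ (1 - α) ∂m) ^ (1 / α) * Q E ^ ((α - 1) / α) := by
        have e1 : 1 / α * α = 1 := by field_simp
        have e2 : (α - 1) / α * (α / (α - 1)) = 1 := by field_simp
        simp_rw [← ENNReal.rpow_mul, e1, e2, ENNReal.rpow_one, ← hQE, one_div_div]
    _ ≤ S ^ (1 / α) * Q E ^ ((α - 1) / α) := by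
        gcongr
        exact setLIntegral_le_lintegral _ _
    _ = (S ^ (α - 1)⁻¹ * Q E) ^ ((α - 1) / α) := by
        rw [ENNReal.mul_rpow_of_nonneg _ _ (by positivity), ← ENNReal.rpow_mul]
        congr 2
        field_simp

section Product

variable {𝒜 ℬ : Type*} [MeasurableSpace 𝒜] [MeasurableSpace ℬ]

lemma prod_le_iSup_section (P : Measure 𝒜) (Q : Measure ℬ) [IsProbabilityMeasure P]
    [IsProbabilityMeasure Q] {E : Set (𝒜 × ℬ)} (hE : MeasurableSet E) :
    P.prod Q E ≤ ⨆ b, P ((fun a => (a, b)) ⁻¹' E) := by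
  rw [Measure.prod_apply_symm hE]
  calc ∫⁻ b, P ((fun a => (a, b)) ⁻¹' E) ∂Q
      ≤ ∫⁻ _, (⨆ b, P ((fun a => (a, b)) ⁻¹' E)) ∂Q :=
        lintegral_mono fun b => le_iSup (fun b => P ((fun a => (a, b)) ⁻¹' E)) b
    _ = _ := by simp

theorem measure_le_exp_sibsonMI_mul_rpow {α : ℝ} (hα : 1 < α) (J : Measure (𝒜 × ℬ))
    [IsProbabilityMeasure J] {E : Set (𝒜 × ℬ)} (hE : MeasurableSet E) (hJ : sibsonMI α J ≠ ⊤) :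
    J E ≤ (EReal.exp (sibsonMI α J) * ⨆ b, J.fst ((fun a => (a, b)) ⁻¹' E)) ^ ((α - 1) / α) := by
  set L := ⨆ b, J.fst ((fun a => (a, b)) ⁻¹' E) with hL
  have hL_top : L ≠ ∞ := ne_top_of_le_ne_top ENNReal.one_ne_top (iSup_le fun _ => prob_le_one)
  have hc : 0 < (α - 1) / α := div_pos (by linarith) (by linarith)
  have hexp : EReal.exp (sibsonMI α J) =
      ⨅ (Q : Measure ℬ) (_ : IsProbabilityMeasure Q), EReal.exp (renyiDiv α J (J.fst.prod Q)) := by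
    simp only [sibsonMI, ← EReal.expOrderIso_apply, OrderIso.map_iInf]
  rw [← ENNReal.rpow_inv_le_iff hc]
  have key : ∀ (Q : Measure ℬ) (_ : IsProbabilityMeasure Q),
      EReal.exp (renyiDiv α J (J.fst.prod Q)) ≠ ∞ →
      J E ^ ((α - 1) / α)⁻¹ ≤ EReal.exp (renyiDiv α J (J.fst.prod Q)) * L := by
    intro Q _ hQ
    rw [ENNReal.rpow_inv_le_iff hc]
    refine (measure_le_exp_renyiDiv_mul_rpow hα J (J.fst.prod Q) E hQ).trans ?_
    gcongr
    exact prod_le_iSup_section _ _ hE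
  -- For `L = 0` division is unavailable, but a single `Q` of finite divergence already forces `J E
  -- = 0`. Otherwise dividing by `L` lets the infimum be taken term by term.
  rcases eq_or_ne L 0 with h0 | h0
  · have : EReal.exp (sibsonMI α J) ≠ ∞ := by simpa using hJ
    rw [hexp] at this
    simp only [ne_eq, iInf_eq_top, not_forall] at this
    obtain ⟨Q, hQ, h⟩ := this
    simpa [h0] using key Q hQ h
  · rw [hexp, ← ENNReal.div_le_iff h0 hL_top]
    refine le_iInf₂ fun Q hQ => ?_
    rcases eq_or_ne (EReal.exp (renyiDiv α J (J.fst.prod Q))) ∞ with h | h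
    · simp [h]
    · rw [ENNReal.div_le_iff h0 hL_top]
      exact key Q hQ h

end Product

/-! ### Maximal leakage -/

section Leakage

variable {𝒜 ℬ : Type*} [MeasurableSpace 𝒜] [MeasurableSpace ℬ]

/-- The channel to a finite alphabet with prescribed transition probabilities `g`. -/
noncomputable def finChannel {n : ℕ} (g : Fin n → 𝒜 → ℝ≥0∞) (hg : ∀ i, Measurable (g i)) :
    Kernel 𝒜 (Fin n) where
  toFun a := ∑ i, g i a • Measure.dirac i
  measurable' := by
    refine Measure.measurable_of_measurable_coe _ fun s _ => ?_
    simp only [Measure.coe_finsetSum, Finset.sum_apply, Measure.smul_apply, smul_eq_mul]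
    fun_prop

lemma finChannel_apply_singleton {n : ℕ} (g : Fin n → 𝒜 → ℝ≥0∞) (hg : ∀ i, Measurable (g i))
    (a : 𝒜) (i : Fin n) : finChannel g hg a {i} = g i a := by
  change (∑ j, g j a • Measure.dirac j : Measure (Fin n)) {i} = _
  simp [Set.indicator_apply]

lemma isMarkovKernel_finChannel {n : ℕ} (g : Fin n → 𝒜 → ℝ≥0∞) (hg : ∀ i, Measurable (g i))
    (h1 : ∀ a, ∑ i, g i a = 1) : IsMarkovKernel (finChannel g hg) := by
  refine ⟨fun a => ⟨?_⟩⟩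
  change (∑ j, g j a • Measure.dirac j : Measure (Fin n)) Set.univ = 1
  simp [h1]

/-- The chain draws `U` from `A` by `g` and guesses `Û = f(B)`: the integral is the success
probability, and `ε` dominates every `ℙ(U = u)`. -/
lemma lintegral_div_le_exp_maximalLeakage (J : Measure (𝒜 × ℬ)) [IsProbabilityMeasure J] {n : ℕ}
    (g : Fin n → 𝒜 → ℝ≥0∞) (hg : ∀ i, Measurable (g i)) (h1 : ∀ a, ∑ i, g i a = 1)
    (f : ℬ → Fin n) (hf : Measurable f) (ε : ℝ≥0∞) (hε : ∀ i, ∫⁻ a, g i a ∂J.fst ≤ ε) :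
    (∫⁻ p, g (f p.2) p.1 ∂J) / ε ≤ EReal.exp (maximalLeakage J) := by
  have hκ := isMarkovKernel_finChannel g hg h1
  rw [← ENNReal.exp_log (_ / ε), EReal.exp_le_exp_iff, maximalLeakage]
  refine le_trans ?_ (le_iSup_of_le n (le_iSup₂_of_le (finChannel g hg) (Kernel.deterministic f hf)
    (le_iSup₂_of_le hκ inferInstance le_rfl)))
  refine ENNReal.log_le_log (ENNReal.div_le_div (le_of_eq ?_) (iSup_le fun u => ?_))
  · rw [Measure.bind_apply (Set.toFinite _).measurableSet (Kernel.aemeasurable _)]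
    refine lintegral_congr fun p => ?_
    rw [Kernel.parallelComp_apply, Kernel.deterministic_apply,
      Measure.prod_apply_symm (Set.toFinite _).measurableSet, lintegral_dirac]
    rw [← finChannel_apply_singleton g hg]
    rfl
  · rw [Measure.bind_apply (measurableSet_singleton u) (Kernel.aemeasurable _)]
    simpa only [finChannel_apply_singleton] using hε u

/-- `U` names a set `A` in the range of `s` with conditional probability `ε c(A) 1_A(a)`, and `Û`
names `s b`. The factor `c(A)` keeps each letter's mass at most `ε`, and `ε` cancels in the ratio.
-/
lemma lintegral_indicator_simpleFunc_le_exp_maximalLeakage (J : Measure (𝒜 × ℬ))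
    [IsProbabilityMeasure J] (s : SimpleFunc ℬ (Set 𝒜)) (hs : ∀ b, MeasurableSet (s b)) :
    ∫⁻ p, (s p.2).indicator
      (fun _ => if J.fst (s p.2) = 0 then 0 else (J.fst (s p.2))⁻¹) p.1 ∂J
      ≤ EReal.exp (maximalLeakage J) := by
  classical
  set c : Set 𝒜 → ℝ≥0∞ := fun A => if J.fst A = 0 then 0 else (J.fst A)⁻¹ with hc
  have hc_top : ∀ A, c A ≠ ∞ := by
    intro A
    by_cases h : J.fst A = 0 <;> simp [hc, h]
  have hcm : ∀ A, c A * J.fst A ≤ 1 := by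
    intro A
    by_cases h : J.fst A = 0
    · simp [hc, h]
    · simp [hc, h, ENNReal.inv_mul_cancel h (measure_ne_top _ _)]
  -- With `ε = 1 / N` the named letters have total probability `r ≤ 1`. The rest is split evenly
  -- among `N` dummy letters, each of mass at most `ε`.
  obtain ⟨N, hN⟩ := ENNReal.exists_nat_gt (r := ∑ A ∈ s.range, c A)
    (ENNReal.sum_ne_top.2 fun A _ => hc_top A)
  have hN0 : (N : ℝ≥0∞) ≠ 0 := (zero_le.trans_lt hN).ne'
  have hNt : (N : ℝ≥0∞) ≠ ∞ := ENNReal.natCast_ne_top N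
  set ε : ℝ≥0∞ := (N : ℝ≥0∞)⁻¹ with hε
  have hε0 : ε ≠ 0 := ENNReal.inv_ne_zero.2 hNt
  have hεt : ε ≠ ∞ := ENNReal.inv_ne_top.2 hN0
  have hmeas : ∀ A ∈ s.range, MeasurableSet A := by
    intro A hA
    obtain ⟨b, rfl⟩ := SimpleFunc.mem_range.1 hA
    exact hs b
  set r : 𝒜 → ℝ≥0∞ := fun a => ∑ A : s.range, ε * A.1.indicator (fun _ => c A.1) a with hr
  have hr1 : ∀ a, r a ≤ 1 := by
    intro a
    calc r a ≤ ∑ A : s.range, ε * c A.1 := by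
          refine Finset.sum_le_sum fun A _ => ?_
          gcongr
          exact Set.indicator_le_self' (fun _ _ => zero_le) a
      _ = ε * ∑ A ∈ s.range, c A := by
          rw [← Finset.mul_sum, Finset.sum_coe_sort s.range c]
      _ ≤ ε * N := by gcongr
      _ = 1 := ENNReal.inv_mul_cancel hN0 hNt
  have hgm : ∀ A : s.range, Measurable fun a => ε * A.1.indicator (fun _ => c A.1) a := fun A =>
    (measurable_const.indicator (hmeas _ A.2)).const_mul _
  have hrm : Measurable r := Finset.measurable_fun_sum _ fun A _ => hgm A
  let e : s.range ⊕ Fin N ≃ Fin (Fintype.card (s.range ⊕ Fin N)) := Fintype.equivFin _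
  let g' : s.range ⊕ Fin N → 𝒜 → ℝ≥0∞ :=
    Sum.elim (fun A a => ε * A.1.indicator (fun _ => c A.1) a) (fun _ a => ε * (1 - r a))
  have hg'm : ∀ i, Measurable (g' i) := by
    rintro (A | j)
    · exact hgm A
    · exact (measurable_const.sub hrm).const_mul _
  have hg'1 : ∀ a, ∑ i, g' i a = 1 := by
    intro a
    rw [Fintype.sum_sum_type]
    simp only [g', Sum.elim_inl, Sum.elim_inr, Finset.sum_const, Finset.card_univ,
      Fintype.card_fin, nsmul_eq_mul]
    rw [← mul_assoc, ENNReal.mul_inv_cancel hN0 hNt, one_mul]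
    exact add_tsub_cancel_of_le (hr1 a)
  have hg'ε : ∀ i, ∫⁻ a, g' i a ∂J.fst ≤ ε := by
    rintro (A | j)
    · simp only [g', Sum.elim_inl]
      rw [lintegral_const_mul _ (measurable_const.indicator (hmeas _ A.2)),
        lintegral_indicator_const (hmeas _ A.2)]
      exact mul_le_of_le_one_right' (hcm _)
    · simp only [g', Sum.elim_inr]
      calc ∫⁻ a, ε * (1 - r a) ∂J.fst ≤ ∫⁻ _, ε ∂J.fst :=
            lintegral_mono fun a => mul_le_of_le_one_right' tsub_le_self
        _ = ε := by simp
  have hn : 0 < N := Nat.pos_of_ne_zero (by simpa using hN0)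
  -- The dummy letter is only a default: `s b` always lies in the range.
  let F : Set 𝒜 → Fin (Fintype.card (s.range ⊕ Fin N)) := fun A =>
    if h : A ∈ s.range then e (.inl ⟨A, h⟩) else e (.inr ⟨0, hn⟩)
  have key := lintegral_div_le_exp_maximalLeakage J (fun i => g' (e.symm i)) (fun i => hg'm _)
    (fun a => by rw [e.symm.sum_comp (fun i => g' i a)]; exact hg'1 a) (s.map F)
    (SimpleFunc.measurable _) ε (fun i => hg'ε _)
  have hF : ∀ p : 𝒜 × ℬ, g' (e.symm (s.map F p.2)) p.1 =
      ε * (s p.2).indicator (fun _ => c (s p.2)) p.1 := by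
    intro p
    simp [F, SimpleFunc.map_apply, g']
  simp only [hF] at key
  rwa [lintegral_const_mul' _ _ hεt, mul_comm ε, ENNReal.mul_div_cancel_right hε0 hεt] at key

lemma measurableSet_mem_simpleFunc (s : SimpleFunc ℬ (Set 𝒜)) (hs : ∀ b, MeasurableSet (s b)) :
    MeasurableSet {p : 𝒜 × ℬ | p.1 ∈ s p.2} := by
  have : {p : 𝒜 × ℬ | p.1 ∈ s p.2} = ⋃ A ∈ s.range, A ×ˢ (s ⁻¹' {A}) := by
    ext p
    simp only [Set.mem_ofPred_eq, Set.mem_iUnion, Set.mem_prod, Set.mem_preimage,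
      Set.mem_singleton_iff, exists_prop]
    exact ⟨fun h => ⟨s p.2, s.mem_range_self _, h, rfl⟩, fun ⟨_, _, h, h'⟩ => h' ▸ h⟩
  rw [this]
  refine Finset.measurableSet_biUnion _ fun A hA => ?_
  obtain ⟨b, rfl⟩ := SimpleFunc.mem_range.1 hA
  exact (hs b).prod (s.measurableSet_fiber _)

/-- Measurable sets of a product are approximated by sets with finitely many measurable
sections. -/
lemma exists_simpleFunc_measure_symmDiff_lt (m : Measure (𝒜 × ℬ)) [IsFiniteMeasure m]
    {E : Set (𝒜 × ℬ)} (hE : MeasurableSet E) {ε : ℝ≥0∞} (hε : 0 < ε) :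
    ∃ s : SimpleFunc ℬ (Set 𝒜), (∀ b, MeasurableSet (s b)) ∧
      m (symmDiff {p | p.1 ∈ s p.2} E) < ε := by
  classical
  let C : Set (Set (𝒜 × ℬ)) :=
    {T | ∃ s : SimpleFunc ℬ (Set 𝒜), (∀ b, MeasurableSet (s b)) ∧ {p | p.1 ∈ s p.2} = T}
  have hrect : ∀ (A : Set 𝒜) (B : Set ℬ), MeasurableSet A → MeasurableSet B → A ×ˢ B ∈ C := by
    intro A B hA hB
    refine ⟨SimpleFunc.piecewise B hB (SimpleFunc.const _ A) (SimpleFunc.const _ ∅), ?_, ?_⟩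
    · intro b
      by_cases h : b ∈ B <;> simp [h, hA]
    · ext p
      by_cases h : p.2 ∈ B <;> simp [h]
  have hmeas : ∀ T ∈ C, MeasurableSet T := by
    rintro _ ⟨s, hs, rfl⟩
    exact measurableSet_mem_simpleFunc s hs
  -- Unions and differences act section by section, and a pair of simple functions is simple.
  have hring : IsSetRing C := by
    refine ⟨⟨SimpleFunc.const _ ∅, by simp, by simp⟩, ?_, ?_⟩
    · rintro _ _ ⟨s, hs, rfl⟩ ⟨t, ht, rfl⟩
      exact ⟨(s.pair t).map fun q : Set 𝒜 × Set 𝒜 => q.1 ∪ q.2, fun b => (hs b).union (ht b), rfl⟩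
    · rintro _ _ ⟨s, hs, rfl⟩ ⟨t, ht, rfl⟩
      exact ⟨(s.pair t).map fun q : Set 𝒜 × Set 𝒜 => q.1 \ q.2, fun b => (hs b).diff (ht b), rfl⟩
  have hgen : (inferInstance : MeasurableSpace (𝒜 × ℬ)) = MeasurableSpace.generateFrom C := by
    refine le_antisymm ?_ (MeasurableSpace.generateFrom_le hmeas)
    rw [show (inferInstance : MeasurableSpace (𝒜 × ℬ)) = _ from generateFrom_prod.symm]
    refine MeasurableSpace.generateFrom_mono ?_
    rintro _ ⟨A, hA, B, hB, rfl⟩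
    exact hrect A B hA hB
  obtain ⟨_, ⟨s, hs, rfl⟩, h⟩ := exists_measure_symmDiff_lt_of_generateFrom_isSetRing (μ := m) hring
    ⟨{Set.univ}, Set.countable_singleton _,
      by simpa using hrect Set.univ Set.univ .univ .univ, by simp⟩ hgen hE hε
  exact ⟨s, hs, h⟩

/-- The approximation `T` of `E` must be close under `J`, to control `J E`, and under the product of
the marginals, to control the sections. Sections of `T` heavier than `L + δ` occur only over a set
`B` of mass at most `δ`; over the rest the leakage bound applies. -/
lemma measure_le_add_exp_maximalLeakage_mul (J : Measure (𝒜 × ℬ)) [IsProbabilityMeasure J]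
    {E : Set (𝒜 × ℬ)} (hE : MeasurableSet E) {L δ : ℝ≥0}
    (hL : ∀ b, J.fst ((fun a => (a, b)) ⁻¹' E) ≤ L) (hδ : 0 < δ) :
    J E ≤ δ * δ + (δ + (L + δ) * EReal.exp (maximalLeakage J)) := by
  classical
  have hδ' : (δ : ℝ≥0∞) ≠ 0 := by simpa using hδ.ne'
  have hδδ : (0 : ℝ≥0∞) < δ * δ := by positivity
  obtain ⟨s, hs, hsE⟩ := exists_simpleFunc_measure_symmDiff_lt (J + J.fst.prod J.snd) hE hδδ
  set T : Set (𝒜 × ℬ) := {p | p.1 ∈ s p.2} with hT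
  rw [Measure.add_apply] at hsE
  have hJD : J (symmDiff T E) ≤ δ * δ := (le_self_add.trans_lt hsE).le
  have hPD : J.fst.prod J.snd (symmDiff T E) ≤ δ * δ := (le_add_self.trans_lt hsE).le
  let B : Set ℬ := s ⁻¹' {A | (L + δ : ℝ≥0∞) < J.fst A}
  have hB : MeasurableSet B := s.measurableSet_preimage _
  have hBδ : J.snd B ≤ δ := by
    obtain ⟨D, hDsub, hDm, hDeq⟩ := exists_measurable_superset (J.fst.prod J.snd) (symmDiff T E)
    rw [← hDeq, Measure.prod_apply_symm hDm] at hPD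
    -- Over `B` the section of the error exceeds `δ`, so a product error of at most `δ * δ` leaves
    -- `B` mass at most `δ`.
    have h1 : δ * J.snd B ≤ (δ : ℝ≥0∞) * δ := by
      refine le_trans ?_ hPD
      rw [← setLIntegral_const]
      refine (setLIntegral_mono_ae' hB (ae_of_all _ fun b hb => ?_)).trans
        (setLIntegral_le_lintegral B _)
      have hb' : (L + δ : ℝ≥0∞) < J.fst (s b) := hb
      have h2 : J.fst (s b) ≤
          J.fst ((fun a => (a, b)) ⁻¹' E) + J.fst ((fun a => (a, b)) ⁻¹' D) := by
        refine le_trans (measure_mono fun a ha => ?_) (measure_union_le _ _)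
        by_cases h : (a, b) ∈ E
        · exact Or.inl h
        · exact Or.inr (hDsub (Or.inl ⟨ha, h⟩))
      have h3 : (L + δ : ℝ≥0∞) ≤ L + J.fst ((fun a => (a, b)) ⁻¹' D) :=
        hb'.le.trans (h2.trans (by gcongr; exact hL b))
      exact (ENNReal.add_le_add_iff_left ENNReal.coe_ne_top).1 h3
    exact (ENNReal.mul_le_mul_iff_right hδ' ENNReal.coe_ne_top).1 h1
  -- `T` has finitely many distinct sections, so the points lying in null ones form a `J`-null set;
  -- elsewhere the weight is a true inverse.
  have hnull : ∀ᵐ p ∂J, p ∈ T → J.fst (s p.2) ≠ 0 := by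
    rw [ae_iff]
    refine measure_mono_null (t := ⋃ A ∈ {A | A ∈ s.range ∧ J.fst A = 0}, Prod.fst ⁻¹' A) ?_ ?_
    · intro p hp
      simp only [Set.mem_ofPred_eq, Classical.not_imp, not_not] at hp
      simp only [Set.mem_iUnion]
      exact ⟨s p.2, ⟨SimpleFunc.mem_range_self s _, hp.2⟩, hp.1⟩
    · refine (measure_biUnion_null_iff
        ((s.range.finite_toSet.subset fun A hA => hA.1).countable)).2 ?_
      rintro A ⟨hA, h0⟩
      obtain ⟨b, rfl⟩ := SimpleFunc.mem_range.1 hA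
      rwa [Measure.fst_apply (hs b)] at h0
  have hgood : J (T ∩ Prod.snd ⁻¹' Bᶜ) ≤ (L + δ) * EReal.exp (maximalLeakage J) := by
    have hLδ : (L + δ : ℝ≥0∞) ≠ ∞ := by finiteness
    refine le_trans ?_ (mul_le_mul_right
      (lintegral_indicator_simpleFunc_le_exp_maximalLeakage J s hs) _)
    rw [← lintegral_const_mul' _ _ hLδ]
    rw [← lintegral_indicator_one ((measurableSet_mem_simpleFunc s hs).inter
      (measurable_snd hB.compl))]
    refine lintegral_mono_ae ?_
    filter_upwards [hnull] with p hp
    by_cases hpT : p ∈ T ∩ Prod.snd ⁻¹' Bᶜ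
    · have h0 := hp hpT.1
      have hle : J.fst (s p.2) ≤ L + δ := not_lt.1 hpT.2
      have hmem : p.1 ∈ s p.2 := hpT.1
      rw [Set.indicator_of_mem hpT, Set.indicator_of_mem hmem, if_neg h0, ← div_eq_mul_inv,
        Pi.one_apply, ENNReal.le_div_iff_mul_le (.inl h0) (.inl (measure_ne_top _ _)), one_mul]
      exact hle
    · rw [Set.indicator_of_notMem hpT]
      exact zero_le
  calc J E ≤ J (symmDiff T E ∪ (Prod.snd ⁻¹' B ∪ (T ∩ Prod.snd ⁻¹' Bᶜ))) := by
        refine measure_mono fun p hp => ?_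
        by_cases hpT : p ∈ T
        · by_cases hpB : p.2 ∈ B
          · exact Or.inr (Or.inl hpB)
          · exact Or.inr (Or.inr ⟨hpT, hpB⟩)
        · exact Or.inl (Or.inr ⟨hp, hpT⟩)
    _ ≤ J (symmDiff T E) + (J (Prod.snd ⁻¹' B) + J (T ∩ Prod.snd ⁻¹' Bᶜ)) :=
        (measure_union_le _ _).trans (by gcongr; exact measure_union_le _ _)
    _ ≤ _ := by
        rw [Measure.snd_apply hB] at hBδ
        gcongr

theorem measure_le_exp_maximalLeakage_mul (J : Measure (𝒜 × ℬ)) [IsProbabilityMeasure J]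
    {E : Set (𝒜 × ℬ)} (hE : MeasurableSet E) (hJ : maximalLeakage J ≠ ⊤) :
    J E ≤ EReal.exp (maximalLeakage J) * ⨆ b, J.fst ((fun a => (a, b)) ⁻¹' E) := by
  have hL_top : (⨆ b, J.fst ((fun a => (a, b)) ⁻¹' E)) ≠ ∞ :=
    ne_top_of_le_ne_top ENNReal.one_ne_top (iSup_le fun _ => prob_le_one)
  have hle : ∀ b, J.fst ((fun a => (a, b)) ⁻¹' E) ≤ ⨆ b, J.fst ((fun a => (a, b)) ⁻¹' E) :=
    fun b => le_iSup (fun b => J.fst ((fun a => (a, b)) ⁻¹' E)) b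
  have hM : EReal.exp (maximalLeakage J) ≠ ∞ := by simpa using hJ
  have key := fun (L δ : ℝ≥0) => measure_le_add_exp_maximalLeakage_mul J hE (L := L) (δ := δ)
  generalize (⨆ b, J.fst ((fun a => (a, b)) ⁻¹' E)) = L at *
  generalize EReal.exp (maximalLeakage J) = M at *
  lift L to ℝ≥0 using hL_top
  lift M to ℝ≥0 using hM
  -- Finiteness of `M` makes the error bound continuous in `δ`, and `δ → 0` leaves `M * L`.
  have hcont : Continuous fun δ : ℝ≥0 => ((δ * δ + (δ + (L + δ) * M) : ℝ≥0) : ℝ≥0∞) := by fun_prop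
  have hlim := (hcont.tendsto 0).mono_left (nhdsWithin_le_nhds (s := Set.Ioi 0))
  have h0 : ((0 * 0 + (0 + (L + 0) * M) : ℝ≥0) : ℝ≥0∞) = M * L := by
    push_cast; ring
  rw [← h0]
  refine ge_of_tendsto hlim ?_
  filter_upwards [self_mem_nhdsWithin] with δ hδ
  simpa using key L δ hle hδ

end Leakage

/-! ### Risk bounds for estimators and the Bayesian risk -/

section Estimation

variable {𝒲 𝒳 𝒱 : Type*} [MeasurableSpace 𝒲] [MeasurableSpace 𝒳] [MeasurableSpace 𝒱]

instance isProbabilityMeasure_jointXW (π : Measure 𝒲) [IsProbabilityMeasure π] (P : Kernel 𝒲 𝒳)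
    [IsMarkovKernel P] : IsProbabilityMeasure (jointXW π P) :=
  Measure.isProbabilityMeasure_map measurable_swap.aemeasurable

/-- A bound for the joint law of `(X, W)` in terms of sections, uniform in the set, bounds the
risk of every estimator from below. -/
lemma lowerBound_le_estimatorRisk (π : Measure 𝒲) [IsProbabilityMeasure π] (P : Kernel 𝒲 𝒳)
    [IsMarkovKernel P] {l : 𝒲 → 𝒱 → ℝ≥0} (hl : Measurable (Function.uncurry l)) {ρ : ℝ}
    (hρ : 0 < ρ) {c : ℝ} (hc : 0 < c) {I : EReal}
    (hI : I ≠ ⊤ → ∀ E, MeasurableSet E → jointXW π P E ≤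
      (EReal.exp I * ⨆ w, (jointXW π P).fst ((fun x => (x, w)) ⁻¹' E)) ^ c)
    {φ : 𝒳 → 𝒱} (hφ : Measurable φ) {L : ℝ≥0∞} (hL : smallBallEst π P l φ ρ ≤ L)
    (h : I ≠ ⊤ ∨ L ≠ 0) :
    lowerBound ρ c I L ≤ (estimatorRisk π P l φ : EReal) := by
  rcases eq_or_ne I ⊤ with rfl | hI'
  · rw [lowerBound_top hρ hc (by simpa using h)]
    exact bot_le
  refine lowerBound_le_coe_of_le_add hρ ?_
  have hm : Measurable fun p : 𝒲 × 𝒳 => l p.1 (φ p.2) :=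
    hl.comp (measurable_fst.prodMk (hφ.comp measurable_snd))
  have hE : MeasurableSet {p : 𝒳 × 𝒲 | (l p.2 (φ p.1) : ℝ) < ρ} :=
    measurableSet_lt (hm.comp measurable_swap).coe_nnreal_real measurable_const
  have hfst : (jointXW π P).fst = P ∘ₘ π := by
    rw [jointXW, Measure.fst_map_swap, Measure.snd_compProd]
  have hsec : ∀ w, (jointXW π P).fst ((fun x => (x, w)) ⁻¹' {p | (l p.2 (φ p.1) : ℝ) < ρ}) =
      estimateLaw π P φ {v | (l w v : ℝ) < ρ} := by
    intro w
    have hlw : Measurable (l w) := hl.comp measurable_prodMk_left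
    rw [hfst, estimateLaw,
      Measure.map_apply hφ (measurableSet_lt hlw.coe_nnreal_real measurable_const)]
    rfl
  refine (le_lintegral_add_mul_measure_lt (π ⊗ₘ P) hm ρ).trans ?_
  rw [estimatorRisk]
  gcongr
  have hJ := hI hI' _ hE
  simp only [hsec] at hJ
  rw [jointXW, Measure.map_apply measurable_swap hE] at hJ
  refine hJ.trans ?_
  gcongr
  exact hL

lemma lowerBound_le_bayesianRisk (π : Measure 𝒲) [IsProbabilityMeasure π] (P : Kernel 𝒲 𝒳)
    [IsMarkovKernel P] {l : 𝒲 → 𝒱 → ℝ≥0} (hl : Measurable (Function.uncurry l)) {ρ : ℝ}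
    (hρ : 0 < ρ) {c : ℝ} (hc : 0 < c) {I : EReal}
    (hI : I ≠ ⊤ → ∀ E, MeasurableSet E → jointXW π P E ≤
      (EReal.exp I * ⨆ w, (jointXW π P).fst ((fun x => (x, w)) ⁻¹' E)) ^ c)
    {Φ : Set (𝒳 → 𝒱)} (hΦ : ∀ φ ∈ Φ, Measurable φ)
    (hR : (⨅ φ ∈ Φ, estimatorRisk π P l φ) = bayesianRisk π P l)
    (h : I ≠ ⊤ ∨ smallBallClass π P l Φ ρ ≠ 0) :
    lowerBound ρ c I (smallBallClass π P l Φ ρ) ≤ (bayesianRisk π P l : EReal) := by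
  have key : ∀ φ ∈ Φ, lowerBound ρ c I (smallBallClass π P l Φ ρ) ≤
      (estimatorRisk π P l φ : EReal) := fun φ hφ =>
    lowerBound_le_estimatorRisk π P hl hρ hc hI (hΦ φ hφ)
      (le_iSup₂ (f := fun φ _ => smallBallEst π P l φ ρ) φ hφ) h
  rw [← hR]
  -- The bound may be negative while the infimum lives in `[0, ∞]`, so it is replaced by its
  -- positive part, which still lies below every risk.
  calc lowerBound ρ c I (smallBallClass π P l Φ ρ)
      ≤ ((lowerBound ρ c I (smallBallClass π P l Φ ρ)).toENNReal : EReal) :=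
        by
        rw [EReal.coe_toENNReal_eq_max]; exact le_max_right _ _
    _ ≤ _ := EReal.coe_ennreal_le_coe_ennreal_iff.2 <| le_iInf₂ fun φ hφ => by
        simpa using EReal.toENNReal_le_toENNReal (key φ hφ)

end Estimation

end BayesLowerBound

theorem mainTheorem9 {𝒲 𝒳 𝒱 : Type*} [MeasurableSpace 𝒲] [MeasurableSpace 𝒳]
    [MeasurableSpace 𝒱] (π : Measure 𝒲) [IsProbabilityMeasure π]
    (P : Kernel 𝒲 𝒳) [IsMarkovKernel P]
    (l : 𝒲 → 𝒱 → ℝ≥0) (hl : Measurable (Function.uncurry l)) (ρ : ℝ) (hρ : 0 < ρ) :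
    -- Sibson's mutual information of order `α > 1`
    (∀ α : ℝ, 1 < α →
      (∀ φ : 𝒳 → 𝒱, Measurable φ →
        ((BayesLowerBound.sibsonMI α (BayesLowerBound.jointXW π P)) ≠ ⊤ ∨ BayesLowerBound.smallBallEst π P l φ ρ ≠ 0) →
        BayesLowerBound.lowerBound ρ ((α - 1) / α) (BayesLowerBound.sibsonMI α (BayesLowerBound.jointXW π P))
            (BayesLowerBound.smallBallEst π P l φ ρ)
          ≤ (BayesLowerBound.estimatorRisk π P l φ : EReal)) ∧
      (∀ Φ : Set (𝒳 → 𝒱), (∀ φ ∈ Φ, Measurable φ) →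
        (⨅ φ ∈ Φ, BayesLowerBound.estimatorRisk π P l φ) = BayesLowerBound.bayesianRisk π P l →
        ((BayesLowerBound.sibsonMI α (BayesLowerBound.jointXW π P)) ≠ ⊤ ∨ BayesLowerBound.smallBallClass π P l Φ ρ ≠ 0) →
        BayesLowerBound.lowerBound ρ ((α - 1) / α) (BayesLowerBound.sibsonMI α (BayesLowerBound.jointXW π P))
            (BayesLowerBound.smallBallClass π P l Φ ρ)
          ≤ (BayesLowerBound.bayesianRisk π P l : EReal))) ∧
    -- maximal leakage, the case `α → ∞`
    (∀ φ : 𝒳 → 𝒱, Measurable φ →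
      ((BayesLowerBound.maximalLeakage (BayesLowerBound.jointXW π P)) ≠ ⊤ ∨ BayesLowerBound.smallBallEst π P l φ ρ ≠ 0) →
      BayesLowerBound.lowerBound ρ 1 (BayesLowerBound.maximalLeakage (BayesLowerBound.jointXW π P))
          (BayesLowerBound.smallBallEst π P l φ ρ)
        ≤ (BayesLowerBound.estimatorRisk π P l φ : EReal)) ∧
    (∀ Φ : Set (𝒳 → 𝒱), (∀ φ ∈ Φ, Measurable φ) →
      (⨅ φ ∈ Φ, BayesLowerBound.estimatorRisk π P l φ) = BayesLowerBound.bayesianRisk π P l →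
      ((BayesLowerBound.maximalLeakage (BayesLowerBound.jointXW π P)) ≠ ⊤ ∨ BayesLowerBound.smallBallClass π P l Φ ρ ≠ 0) →
      BayesLowerBound.lowerBound ρ 1 (BayesLowerBound.maximalLeakage (BayesLowerBound.jointXW π P))
          (BayesLowerBound.smallBallClass π P l Φ ρ)
        ≤ (BayesLowerBound.bayesianRisk π P l : EReal)) := by
  refine ⟨fun α hα => ?_, ?_⟩
  · have hc : 0 < (α - 1) / α := div_pos (by linarith) (by linarith)
    have hI := fun hJ (E : Set (𝒳 × 𝒲)) (hE : MeasurableSet E) =>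
      BayesLowerBound.measure_le_exp_sibsonMI_mul_rpow hα (BayesLowerBound.jointXW π P) hE hJ
    exact ⟨fun φ hφ h =>
        BayesLowerBound.lowerBound_le_estimatorRisk π P hl hρ hc hI hφ le_rfl h,
      fun Φ hΦ hR h => BayesLowerBound.lowerBound_le_bayesianRisk π P hl hρ hc hI hΦ hR h⟩
  · have hI := fun hJ (E : Set (𝒳 × 𝒲)) (hE : MeasurableSet E) =>
      (BayesLowerBound.measure_le_exp_maximalLeakage_mul (BayesLowerBound.jointXW π P) hE hJ).trans
        (ENNReal.rpow_one _).ge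
    exact ⟨fun φ hφ h =>
        BayesLowerBound.lowerBound_le_estimatorRisk π P hl hρ one_pos hI hφ le_rfl h,
      fun Φ hΦ hR h => BayesLowerBound.lowerBound_le_bayesianRisk π P hl hρ one_pos hI hΦ hR h⟩
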